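/- \textbf{Theorem.} The $\pi$-calculus is strongly replacement free. Here the $\pi$-calculus (monadic, without match), over an infinite set of names, has the processes $$P,Q ::= \mathbf 0 \mid \mu.P \mid P+Q \mid (P\,|\,Q) \mid (\nu x)P \mid\, !P,\qquad \mu ::= \tau \mid a(x) \mid \bar a b,$$ where $x$ is bound in $a(x).P$ and in $(\nu x)P$ and $\alpha$-equivalent processes are identified, with the standard early labelled transition system $P\xrightarrow{\mu}P'$; its labels are the invisible action $\tau$ and the visible actions $ab$ (input), $\bar a b$ (free output) and $\bar a(z)$ (bound output). Write $\Rightarrow$ for the reflexive and transitive closure of $\xrightarrow{\tau}$. A process $P$ is \emph{visible}, written $P\Downarrow$, if $P\Rightarrow\xrightarrow{\alpha}\Rightarrow P'$ for some visible action $\alpha$ and some process $P'$; otherwise $P$ is \emph{invisible}. A \emph{context} $C$ is a process in which exactly one sub-term is replaced by a hole, and $C[P]$ is the process obtained by putting $P$ literally into the hole (so free names of $P$ may become bound by $C$). A calculus is \emph{strongly replacement free} if for every context $C$, every invisible process $I$ and every process $P$, $$C[I]\Downarrow\quad\text{implies}\quad C[P]\Downarrow .$$ -/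

import Mathlib

/-! ## Calculi given by a labelled transition system, and strong replacement freeness -/

/-- A calculus: its terms, its one-hole contexts together with the operation `C[P]` of filling the
hole, and its operational semantics, a labelled transition system. The invisible actions are
indistinguishable and denoted by the single label `tau`; all other actions are visible. -/
structure Calculus.{u} where
  Term : Type u
  Context : Type u
  fill : Context → Term → Term
  Action : Type u
  tau : Action
  Step : Term → Action → Term → Prop

namespace Calculus

variable (L : Calculus)

/-- `P ⟹ P'`, the reflexive and transitive closure of the `tau`-labelled transitions. -/
def WeakTau : L.Term → L.Term → Prop :=
  Relation.ReflTransGen (fun P P' => L.Step P L.tau P')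

/-- `P ⟹ -μ→ ⟹ P'`. -/
def WeakStep (P : L.Term) (μ : L.Action) (P' : L.Term) : Prop :=
  ∃ Q Q', L.WeakTau P Q ∧ L.Step Q μ Q' ∧ L.WeakTau Q' P'

/-- `P` can perform the action `α`, possibly after some internal steps. -/
def CanPerform (P : L.Term) (α : L.Action) : Prop :=
  ∃ P', L.WeakStep P α P'

/-- `P` is visible: it can perform some visible action. -/
def Visible (P : L.Term) : Prop :=
  ∃ α, α ≠ L.tau ∧ L.CanPerform P α

/-- `P` is invisible: there is no visible action that it can perform. -/
def Invisible (P : L.Term) : Prop :=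
  ¬ ∃ α, α ≠ L.tau ∧ L.CanPerform P α

/-- For every context `C`, invisible `I` and arbitrary `P`: if `C[I]` is visible, so is `C[P]`. -/
def StronglyReplacementFree : Prop :=
  ∀ (C : L.Context) (I P : L.Term),
    L.Invisible I → L.Visible (L.fill C I) → L.Visible (L.fill C P)

end Calculus

/-! ## The pi-calculus (monadic, without match) -/

namespace Pi

/-- `P, Q ::= 0 | μ.P | P + Q | P ∣ Q | (ν x) P | !P`, with prefixes `μ ::= τ | a(x) | a⟨b⟩`
(`a⟨b⟩` is the output of `b` along `a`). The name `x` is bound in `inp a x P` and in `res x P`. -/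
inductive Proc (Name : Type*) : Type _ where
  | nil : Proc Name
  | tau (P : Proc Name) : Proc Name
  | inp (a x : Name) (P : Proc Name) : Proc Name
  | out (a b : Name) (P : Proc Name) : Proc Name
  | sum (P Q : Proc Name) : Proc Name
  | par (P Q : Proc Name) : Proc Name
  | res (x : Name) (P : Proc Name) : Proc Name
  | rep (P : Proc Name) : Proc Name

/-- One-hole contexts: terms in which exactly one sub-term is replaced by a hole. -/
inductive Ctx (Name : Type*) : Type _ where
  | hole : Ctx Name
  | tau (C : Ctx Name) : Ctx Name
  | inp (a x : Name) (C : Ctx Name) : Ctx Name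
  | out (a b : Name) (C : Ctx Name) : Ctx Name
  | sumL (C : Ctx Name) (Q : Proc Name) : Ctx Name
  | sumR (P : Proc Name) (C : Ctx Name) : Ctx Name
  | parL (C : Ctx Name) (Q : Proc Name) : Ctx Name
  | parR (P : Proc Name) (C : Ctx Name) : Ctx Name
  | res (x : Name) (C : Ctx Name) : Ctx Name
  | rep (C : Ctx Name) : Ctx Name

/-- `C[P]`: literal replacement of the hole, so free names of `P` may become bound. -/
def Ctx.fill {Name : Type*} : Ctx Name → Proc Name → Proc Name
  | .hole, P => P
  | .tau C, P => .tau (C.fill P)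
  | .inp a x C, P => .inp a x (C.fill P)
  | .out a b C, P => .out a b (C.fill P)
  | .sumL C Q, P => .sum (C.fill P) Q
  | .sumR R C, P => .sum R (C.fill P)
  | .parL C Q, P => .par (C.fill P) Q
  | .parR R C, P => .par R (C.fill P)
  | .res x C, P => .res x (C.fill P)
  | .rep C, P => .rep (C.fill P)

/-- The labels of the early transition system: `τ`, input of `b` along `a`, (free) output of `b`
along `a`, and bound output along `a` of the private name `z`, which is bound in the label. -/
inductive Act (Name : Type*) : Type _ where
  | tau : Act Name
  | inp (a b : Name) : Act Name
  | out (a b : Name) : Act Name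
  | bout (a z : Name) : Act Name

/-- Some name outside a given finite set of names. -/
noncomputable def fresh {Name : Type*} [Infinite Name] (S : Finset Name) : Name :=
  Classical.choose (Infinite.exists_notMem_finset S)

theorem fresh_notMem {Name : Type*} [Infinite Name] (S : Finset Name) : fresh S ∉ S :=
  Classical.choose_spec (Infinite.exists_notMem_finset S)

section

variable {Name : Type*} [DecidableEq Name]

/-- All names of an action, free or bound. -/
def Act.names : Act Name → Finset Name
  | .tau => ∅
  | .inp a b => {a, b}
  | .out a b => {a, b}
  | .bout a z => {a, z}

/-- The bound names of an action. -/
def Act.bn : Act Name → Finset Name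
  | .tau => ∅
  | .inp _ _ => ∅
  | .out _ _ => ∅
  | .bout _ z => {z}

/-- The free names of a term. -/
def Proc.fn : Proc Name → Finset Name
  | .nil => ∅
  | .tau P => P.fn
  | .inp a x P => insert a (P.fn.erase x)
  | .out a b P => insert a (insert b P.fn)
  | .sum P Q => P.fn ∪ Q.fn
  | .par P Q => P.fn ∪ Q.fn
  | .res x P => P.fn.erase x
  | .rep P => P.fn

variable [Infinite Name]

/-- Capture-avoiding simultaneous substitution of `σ n` for every free name `n`. At a binder `x`
with body `P`, the bound name is replaced by one that differs from all the names substituted for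
the free names of `P` other than `x`. -/
noncomputable def Proc.subst : (Name → Name) → Proc Name → Proc Name
  | _, .nil => .nil
  | σ, .tau P => .tau (P.subst σ)
  | σ, .inp a x P =>
      .inp (σ a) (fresh ((P.fn.erase x).image σ))
        (P.subst (Function.update σ x (fresh ((P.fn.erase x).image σ))))
  | σ, .out a b P => .out (σ a) (σ b) (P.subst σ)
  | σ, .sum P Q => .sum (P.subst σ) (Q.subst σ)
  | σ, .par P Q => .par (P.subst σ) (Q.subst σ)
  | σ, .res x P =>
      .res (fresh ((P.fn.erase x).image σ))
        (P.subst (Function.update σ x (fresh ((P.fn.erase x).image σ))))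
  | σ, .rep P => .rep (P.subst σ)

/-- `P{b/x}`. -/
noncomputable def Proc.subst1 (P : Proc Name) (x b : Name) : Proc Name :=
  P.subst (Function.update id x b)

/-- Alpha-equivalence: the least congruence that allows to rename a bound name `x` of a body `P`
to any name `y` that is not free in `P`. -/
inductive AlphaEq : Proc Name → Proc Name → Prop
  | refl (P) : AlphaEq P P
  | symm {P Q} : AlphaEq P Q → AlphaEq Q P
  | trans {P Q R} : AlphaEq P Q → AlphaEq Q R → AlphaEq P R
  | inp_rename (a x y P) : y ∉ P.fn → AlphaEq (.inp a x P) (.inp a y (P.subst1 x y))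
  | res_rename (x y P) : y ∉ P.fn → AlphaEq (.res x P) (.res y (P.subst1 x y))
  | tau {P P'} : AlphaEq P P' → AlphaEq (.tau P) (.tau P')
  | inp (a x) {P P'} : AlphaEq P P' → AlphaEq (.inp a x P) (.inp a x P')
  | out (a b) {P P'} : AlphaEq P P' → AlphaEq (.out a b P) (.out a b P')
  | sum {P P' Q Q'} : AlphaEq P P' → AlphaEq Q Q' → AlphaEq (.sum P Q) (.sum P' Q')
  | par {P P' Q Q'} : AlphaEq P P' → AlphaEq Q Q' → AlphaEq (.par P Q) (.par P' Q')
  | res (x) {P P'} : AlphaEq P P' → AlphaEq (.res x P) (.res x P')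
  | rep {P P'} : AlphaEq P P' → AlphaEq (.rep P) (.rep P')

/-- The early labelled transition system of the pi-calculus. The rule `alpha` expresses that
alpha-equivalent terms are identified. -/
inductive Step : Proc Name → Act Name → Proc Name → Prop
  | alpha {P P₁ Q₁ Q μ} : AlphaEq P P₁ → Step P₁ μ Q₁ → AlphaEq Q₁ Q → Step P μ Q
  | tau (P) : Step (.tau P) .tau P
  | inp (a x b P) : Step (.inp a x P) (.inp a b) (P.subst1 x b)
  | out (a b P) : Step (.out a b P) (.out a b) P
  | sumL {P P' μ} (Q) : Step P μ P' → Step (.sum P Q) μ P'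
  | sumR {Q Q' μ} (P) : Step Q μ Q' → Step (.sum P Q) μ Q'
  | parL {P P' μ} (Q) : (∀ z ∈ μ.bn, z ∉ Q.fn) → Step P μ P' → Step (.par P Q) μ (.par P' Q)
  | parR {Q Q' μ} (P) : (∀ z ∈ μ.bn, z ∉ P.fn) → Step Q μ Q' → Step (.par P Q) μ (.par P Q')
  | commL {P P' Q Q' a b} :
      Step P (.out a b) P' → Step Q (.inp a b) Q' → Step (.par P Q) .tau (.par P' Q')
  | commR {P P' Q Q' a b} :
      Step P (.inp a b) P' → Step Q (.out a b) Q' → Step (.par P Q) .tau (.par P' Q')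
  | closeL {P P' Q Q' a z} : z ∉ Q.fn →
      Step P (.bout a z) P' → Step Q (.inp a z) Q' → Step (.par P Q) .tau (.res z (.par P' Q'))
  | closeR {P P' Q Q' a z} : z ∉ P.fn →
      Step P (.inp a z) P' → Step Q (.bout a z) Q' → Step (.par P Q) .tau (.res z (.par P' Q'))
  | res {P P' μ} (x) : x ∉ μ.names → Step P μ P' → Step (.res x P) μ (.res x P')
  | opn {P P' a z} : z ≠ a → Step P (.out a z) P' → Step (.res z P) (.bout a z) P'
  | rep {P P' μ} : Step (.par P (.rep P)) μ P' → Step (.rep P) μ P'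

end

/-- The pi-calculus over a given infinite set of names, as a calculus. -/
def calculus (Name : Type*) [DecidableEq Name] [Infinite Name] : Calculus where
  Term := Proc Name
  Context := Ctx Name
  fill := Ctx.fill
  Action := Act Name
  tau := Act.tau
  Step := Step

end Pi

/-! ## Well-scoped terms -/

namespace Pi

universe u

/-! The crux is that invisibility survives every substitution of names, injective or not. Without
match, identifying names can only enable new internal communications. One partner of such a
communication acts on one of the identified channels, and this action was visible before the
substitution: a restriction cannot hide it, because a capture-avoiding substitution never identifies
a restricted name with another name. This is `Trans.reflect`; `Scoped.Visible.of_map` follows.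

Now let `C[P]` imitate `C[I]`. An invisible sub-term cannot communicate with its surroundings, since
that would need a visible action. Its internal steps lead to invisible terms again and are imitated
by doing nothing; every other step is imitated by the same step. Names received by the context, and
names captured by it, act on the sub-term as substitutions and so leave it invisible. Hence the
relation `Sim` is preserved by transitions (`Sim.answers`) and transports visibility
(`Sim.visible`).

The argument runs on well-scoped terms, where alpha-equivalence is equality and an input leads to an
abstraction, with nothing received yet. `Step.embeds` and `Trans.performs` match this semantics with
the early one on named terms, so that visibility is the same in both (`visible_iff`). -/

/-- Terms over the names `V`, up to alpha-equivalence: a binder adds the name `none`. -/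
inductive Scoped : Type u → Type (u + 1)
  | nil {V} : Scoped V
  | tau {V} (A : Scoped V) : Scoped V
  | inp {V} (a : V) (A : Scoped (Option V)) : Scoped V
  | out {V} (a b : V) (A : Scoped V) : Scoped V
  | sum {V} (A B : Scoped V) : Scoped V
  | par {V} (A B : Scoped V) : Scoped V
  | res {V} (A : Scoped (Option V)) : Scoped V
  | rep {V} (A : Scoped V) : Scoped V

/-- Simultaneous substitution of names. -/
def Scoped.map : {V W : Type u} → (V → W) → Scoped V → Scoped W
  | _, _, _, .nil => .nil
  | _, _, f, .tau A => .tau (A.map f)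
  | _, _, f, .inp a A => .inp (f a) (A.map (Option.map f))
  | _, _, f, .out a b A => .out (f a) (f b) (A.map f)
  | _, _, f, .sum A B => .sum (A.map f) (B.map f)
  | _, _, f, .par A B => .par (A.map f) (B.map f)
  | _, _, f, .res A => .res (A.map (Option.map f))
  | _, _, f, .rep A => .rep (A.map f)

theorem Scoped.map_id {V : Type u} (A : Scoped V) : A.map id = A := by
  induction A <;> simp_all [Scoped.map]

theorem Scoped.map_map {V W X : Type u} (f : V → W) (g : W → X) (A : Scoped V) :
    (A.map f).map g = A.map (g ∘ f) := by
  induction A generalizing W X <;> simp_all [Scoped.map]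

theorem Scoped.map_eq_self {V : Type u} {f : V → V} (h : ∀ v, f v = v) (A : Scoped V) :
    A.map f = A := by
  rw [show f = id from funext h, Scoped.map_id]

/-- Substitution of `b` for the name added by a binder. -/
def inst {V : Type u} (b : V) : Option V → V
  | none => b
  | some v => v

/-- Exchange of the names added by two consecutive binders. -/
def swap {V : Type u} : Option (Option V) → Option (Option V)
  | none => some none
  | some none => none
  | some (some v) => some (some v)

/-- What a term can become: an action together with the term after it. The received name
of an input and the extruded name of a bound output are the name added to the target. -/
inductive Residual (V : Type u) : Type (u + 1)
  | tau (A : Scoped V) : Residual V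
  | inp (a : V) (A : Scoped (Option V)) : Residual V
  | out (a b : V) (A : Scoped V) : Residual V
  | bout (a : V) (A : Scoped (Option V)) : Residual V

namespace Residual

variable {V W : Type u}

/-- The channel of a visible action. -/
def subject : Residual V → Option V
  | .tau _ => none
  | .inp a _ => some a
  | .out a _ _ => some a
  | .bout a _ => some a

def map (f : V → W) : Residual V → Residual W
  | .tau A => .tau (A.map f)
  | .inp a A => .inp (f a) (A.map (Option.map f))
  | .out a b A => .out (f a) (f b) (A.map f)
  | .bout a A => .bout (f a) (A.map (Option.map f))

/-- Put `B` in parallel, on the right. -/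
def parL (B : Scoped V) : Residual V → Residual V
  | .tau A => .tau (.par A B)
  | .inp a A => .inp a (.par A (B.map some))
  | .out a b A => .out a b (.par A B)
  | .bout a A => .bout a (.par A (B.map some))

/-- Put `A` in parallel, on the left. -/
def parR (A : Scoped V) : Residual V → Residual V
  | .tau B => .tau (.par A B)
  | .inp a B => .inp a (.par (A.map some) B)
  | .out a b B => .out a b (.par A B)
  | .bout a B => .bout a (.par (A.map some) B)

theorem subject_map (f : V → W) (r : Residual V) : (r.map f).subject = r.subject.map f := by
  cases r <;> rfl

theorem subject_parL (B : Scoped V) (r : Residual V) : (r.parL B).subject = r.subject := by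
  cases r <;> rfl

theorem subject_parR (B : Scoped V) (r : Residual V) : (r.parR B).subject = r.subject := by
  cases r <;> rfl

theorem map_parL (f : V → W) (B : Scoped V) (r : Residual V) :
    (r.parL B).map f = (r.map f).parL (B.map f) := by
  cases r <;> simp [parL, map, Scoped.map, Scoped.map_map]

theorem map_parR (f : V → W) (B : Scoped V) (r : Residual V) :
    (r.parR B).map f = (r.map f).parR (B.map f) := by
  cases r <;> simp [parR, map, Scoped.map, Scoped.map_map]

end Residual

/-- The transitions of well-scoped terms. -/
inductive Trans : {V : Type u} → Scoped V → Residual V → Prop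
  | tau {V} (A : Scoped V) : Trans (.tau A) (.tau A)
  | inp {V} (a : V) (A) : Trans (.inp a A) (.inp a A)
  | out {V} (a b : V) (A) : Trans (.out a b A) (.out a b A)
  | sumL {V} {A : Scoped V} {r} (B) : Trans A r → Trans (.sum A B) r
  | sumR {V} {B : Scoped V} {r} (A) : Trans B r → Trans (.sum A B) r
  | parL {V} {A : Scoped V} {r} (B) : Trans A r → Trans (.par A B) (r.parL B)
  | parR {V} {B : Scoped V} {r} (A) : Trans B r → Trans (.par A B) (r.parR A)
  | commL {V} {A B : Scoped V} {a b A' B'} : Trans A (.out a b A') → Trans B (.inp a B') →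
      Trans (.par A B) (.tau (.par A' (B'.map (inst b))))
  | commR {V} {A B : Scoped V} {a b A' B'} : Trans A (.inp a A') → Trans B (.out a b B') →
      Trans (.par A B) (.tau (.par (A'.map (inst b)) B'))
  | closeL {V} {A B : Scoped V} {a A' B'} : Trans A (.bout a A') → Trans B (.inp a B') →
      Trans (.par A B) (.tau (.res (.par A' B')))
  | closeR {V} {A B : Scoped V} {a A' B'} : Trans A (.inp a A') → Trans B (.bout a B') →
      Trans (.par A B) (.tau (.res (.par A' B')))
  | resTau {V} {A : Scoped (Option V)} {A'} : Trans A (.tau A') → Trans (.res A) (.tau (.res A'))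
  | resInp {V} {A : Scoped (Option V)} {a A'} : Trans A (.inp (some a) A') →
      Trans (.res A) (.inp a (.res (A'.map swap)))
  | resOut {V} {A : Scoped (Option V)} {a b A'} : Trans A (.out (some a) (some b) A') →
      Trans (.res A) (.out a b (.res A'))
  | resBout {V} {A : Scoped (Option V)} {a A'} : Trans A (.bout (some a) A') →
      Trans (.res A) (.bout a (.res (A'.map swap)))
  | opn {V} {A : Scoped (Option V)} {a A'} : Trans A (.out (some a) none A') →
      Trans (.res A) (.bout a A')
  | rep {V} {A : Scoped V} {r} : Trans (.par A (.rep A)) r → Trans (.rep A) r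

/-- Restriction hides only actions on the restricted channel itself: an output whose object is
restricted reappears as a bound output, with the same channel. -/
theorem Trans.exists_res {V : Type u} {A : Scoped (Option V)} {r : Residual (Option V)} {a : V}
    (h : Trans A r) (ha : r.subject = some (some a)) :
    ∃ s, Trans (.res A) s ∧ s.subject = some a := by
  match r with
  | .tau _ => simp [Residual.subject] at ha
  | .inp c _ => obtain rfl : c = some a := by simpa [Residual.subject] using ha
                exact ⟨_, .resInp h, rfl⟩
  | .bout c _ => obtain rfl : c = some a := by simpa [Residual.subject] using ha
                 exact ⟨_, .resBout h, rfl⟩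
  | .out c none _ => obtain rfl : c = some a := by simpa [Residual.subject] using ha
                     exact ⟨_, .opn h, rfl⟩
  | .out c (some _) _ => obtain rfl : c = some a := by simpa [Residual.subject] using ha
                         exact ⟨_, .resOut h, rfl⟩

/-! ### Inversion of substitution -/

section map_eq

variable {V W : Type u} {f : W → V} {E : Scoped W}

theorem Scoped.map_eq_tau {A : Scoped V} (h : E.map f = .tau A) :
    ∃ A₀, E = .tau A₀ ∧ A₀.map f = A := by
  cases E <;> simp_all [Scoped.map]

theorem Scoped.map_eq_inp {a} {A : Scoped (Option V)} (h : E.map f = .inp a A) :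
    ∃ a₀ A₀, E = .inp a₀ A₀ ∧ f a₀ = a ∧ A₀.map (Option.map f) = A := by
  cases E <;> simp_all [Scoped.map]

theorem Scoped.map_eq_out {a b} {A : Scoped V} (h : E.map f = .out a b A) :
    ∃ a₀ b₀ A₀, E = .out a₀ b₀ A₀ ∧ f a₀ = a ∧ f b₀ = b ∧ A₀.map f = A := by
  cases E <;> simp_all [Scoped.map]

theorem Scoped.map_eq_sum {A B : Scoped V} (h : E.map f = .sum A B) :
    ∃ A₀ B₀, E = .sum A₀ B₀ ∧ A₀.map f = A ∧ B₀.map f = B := by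
  cases E <;> simp_all [Scoped.map]

theorem Scoped.map_eq_par {A B : Scoped V} (h : E.map f = .par A B) :
    ∃ A₀ B₀, E = .par A₀ B₀ ∧ A₀.map f = A ∧ B₀.map f = B := by
  cases E <;> simp_all [Scoped.map]

theorem Scoped.map_eq_res {A : Scoped (Option V)} (h : E.map f = .res A) :
    ∃ A₀, E = .res A₀ ∧ A₀.map (Option.map f) = A := by
  cases E <;> simp_all [Scoped.map]

theorem Scoped.map_eq_rep {A : Scoped V} (h : E.map f = .rep A) :
    ∃ A₀, E = .rep A₀ ∧ A₀.map f = A := by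
  cases E <;> simp_all [Scoped.map]

variable {r : Residual W}

theorem Residual.map_eq_tau {A : Scoped V} (h : r.map f = .tau A) :
    ∃ A₀, r = .tau A₀ ∧ A₀.map f = A := by
  cases r <;> simp_all [Residual.map]

theorem Residual.map_eq_inp {a} {A : Scoped (Option V)} (h : r.map f = .inp a A) :
    ∃ a₀ A₀, r = .inp a₀ A₀ ∧ f a₀ = a ∧ A₀.map (Option.map f) = A := by
  cases r <;> simp_all [Residual.map]

theorem Residual.map_eq_out {a b} {A : Scoped V} (h : r.map f = .out a b A) :
    ∃ a₀ b₀ A₀, r = .out a₀ b₀ A₀ ∧ f a₀ = a ∧ f b₀ = b ∧ A₀.map f = A := by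
  cases r <;> simp_all [Residual.map]

theorem Residual.map_eq_bout {a} {A : Scoped (Option V)} (h : r.map f = .bout a A) :
    ∃ a₀ A₀, r = .bout a₀ A₀ ∧ f a₀ = a ∧ A₀.map (Option.map f) = A := by
  cases r <;> simp_all [Residual.map]

end map_eq

/-! ### Reflection of transitions along a substitution -/

theorem inst_map {V W : Type u} (f : V → W) (b : V) :
    f ∘ inst b = inst (f b) ∘ Option.map f := by
  funext o; cases o <;> rfl

theorem swap_map {V W : Type u} (f : V → W) :
    Option.map (Option.map f) ∘ swap = swap ∘ Option.map (Option.map f) := by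
  funext o; rcases o with _ | _ | _ <;> rfl

/-- `r`, a transition of `E.map f`, comes from one of `E`. -/
def Lifts {V W : Type u} (f : W → V) (E : Scoped W) (r : Residual V) : Prop :=
  ∃ s, Trans E s ∧ s.map f = r

/-- `f` identifies two names, and `E` has a transition with one of them as its subject. -/
def Merges {V W : Type u} (f : W → V) (E : Scoped W) : Prop :=
  ∃ s a a', Trans E s ∧ s.subject = some a ∧ a ≠ a' ∧ f a = f a'

/-- `Option.map f` identifies `none` with nothing else, so both identified names exist outside the
binder and the action is not hidden. Mere visibility would not pass through a restriction; this is
why `Merges` records the second name. -/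
theorem Merges.res {V W : Type u} {f : W → V} {E : Scoped (Option W)}
    (h : Merges (Option.map f) E) : Merges f (.res E) := by
  obtain ⟨s, a, a', hs, ha, hne, he⟩ := h
  rcases a with _ | a <;> rcases a' with _ | a' <;> simp at hne he
  obtain ⟨s', hs', ha'⟩ := hs.exists_res ha
  exact ⟨s', a, a', hs', ha', hne, he⟩

/-- A transition of a substitution instance that does not come from the original term is
internal, and due to the identification of two names. -/
theorem Trans.reflect {V : Type u} {A : Scoped V} {r : Residual V} (h : Trans A r) :
    ∀ {W : Type u} (f : W → V) (E : Scoped W), E.map f = A →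
      Lifts f E r ∨ (r.subject = none ∧ Merges f E) := by
  induction h with
  | tau A =>
    intro W f E hE
    obtain ⟨A, rfl, rfl⟩ := Scoped.map_eq_tau hE
    exact .inl ⟨_, .tau _, rfl⟩
  | inp a A =>
    intro W f E hE
    obtain ⟨a, A, rfl, rfl, rfl⟩ := Scoped.map_eq_inp hE
    exact .inl ⟨_, .inp _ _, rfl⟩
  | out a b A =>
    intro W f E hE
    obtain ⟨a, b, A, rfl, rfl, rfl, rfl⟩ := Scoped.map_eq_out hE
    exact .inl ⟨_, .out _ _ _, rfl⟩
  | sumL B _ ih =>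
    intro W f E hE
    obtain ⟨A, B, rfl, rfl, rfl⟩ := Scoped.map_eq_sum hE
    rcases ih f A rfl with ⟨s, hs, rfl⟩ | ⟨hr, s, a, a', hs, hm⟩
    · exact .inl ⟨s, .sumL _ hs, rfl⟩
    · exact .inr ⟨hr, s, a, a', .sumL _ hs, hm⟩
  | sumR A _ ih =>
    intro W f E hE
    obtain ⟨A, B, rfl, rfl, rfl⟩ := Scoped.map_eq_sum hE
    rcases ih f B rfl with ⟨s, hs, rfl⟩ | ⟨hr, s, a, a', hs, hm⟩
    · exact .inl ⟨s, .sumR _ hs, rfl⟩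
    · exact .inr ⟨hr, s, a, a', .sumR _ hs, hm⟩
  | parL B _ ih =>
    intro W f E hE
    obtain ⟨A, B, rfl, rfl, rfl⟩ := Scoped.map_eq_par hE
    rcases ih f A rfl with ⟨s, hs, rfl⟩ | ⟨hr, s, a, a', hs, ha, hm⟩
    · exact .inl ⟨_, .parL _ hs, Residual.map_parL ..⟩
    · exact .inr ⟨by rwa [Residual.subject_parL], _, a, a', .parL _ hs,
        by rwa [Residual.subject_parL], hm⟩
  | parR A _ ih =>
    intro W f E hE
    obtain ⟨A, B, rfl, rfl, rfl⟩ := Scoped.map_eq_par hE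
    rcases ih f B rfl with ⟨s, hs, rfl⟩ | ⟨hr, s, a, a', hs, ha, hm⟩
    · exact .inl ⟨_, .parR _ hs, Residual.map_parR ..⟩
    · exact .inr ⟨by rwa [Residual.subject_parR], _, a, a', .parR _ hs,
        by rwa [Residual.subject_parR], hm⟩
  | commL _ _ ih₁ ih₂ =>
    intro W f E hE
    obtain ⟨A, B, rfl, rfl, rfl⟩ := Scoped.map_eq_par hE
    rcases ih₁ f A rfl with ⟨s, hs, e⟩ | ⟨hr, -⟩
    -- The premises of a communication are visible, so they always lift.
    swap; · simp [Residual.subject] at hr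
    rcases ih₂ f B rfl with ⟨t, ht, e'⟩ | ⟨hr, -⟩
    swap; · simp [Residual.subject] at hr
    obtain ⟨a, b, A', rfl, rfl, rfl, rfl⟩ := Residual.map_eq_out e
    obtain ⟨a', B', rfl, ha, rfl⟩ := Residual.map_eq_inp e'
    -- The channels agree after `f`. If they already agreed, the communication lifts; otherwise the
    -- input alone is a visible action of `E` on an identified name.
    by_cases haa : a' = a
    · subst haa
      refine .inl ⟨_, .commL hs ht, ?_⟩
      simp [Residual.map, Scoped.map, Scoped.map_map, inst_map]
    · exact .inr ⟨rfl, _, a', a, .parR _ ht, rfl, haa, ha⟩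
  | commR _ _ ih₁ ih₂ =>
    intro W f E hE
    obtain ⟨A, B, rfl, rfl, rfl⟩ := Scoped.map_eq_par hE
    rcases ih₁ f A rfl with ⟨s, hs, e⟩ | ⟨hr, -⟩
    swap; · simp [Residual.subject] at hr
    rcases ih₂ f B rfl with ⟨t, ht, e'⟩ | ⟨hr, -⟩
    swap; · simp [Residual.subject] at hr
    obtain ⟨a, b, A', rfl, rfl, rfl, rfl⟩ := Residual.map_eq_out e'
    obtain ⟨a', B', rfl, ha, rfl⟩ := Residual.map_eq_inp e
    by_cases haa : a' = a
    · subst haa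
      refine .inl ⟨_, .commR hs ht, ?_⟩
      simp [Residual.map, Scoped.map, Scoped.map_map, inst_map]
    · exact .inr ⟨rfl, _, a', a, .parL _ hs, rfl, haa, ha⟩
  | closeL _ _ ih₁ ih₂ =>
    intro W f E hE
    obtain ⟨A, B, rfl, rfl, rfl⟩ := Scoped.map_eq_par hE
    rcases ih₁ f A rfl with ⟨s, hs, e⟩ | ⟨hr, -⟩
    swap; · simp [Residual.subject] at hr
    rcases ih₂ f B rfl with ⟨t, ht, e'⟩ | ⟨hr, -⟩
    swap; · simp [Residual.subject] at hr
    obtain ⟨a, A', rfl, rfl, rfl⟩ := Residual.map_eq_bout e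
    obtain ⟨a', B', rfl, ha, rfl⟩ := Residual.map_eq_inp e'
    by_cases haa : a' = a
    · subst haa
      exact .inl ⟨_, .closeL hs ht, rfl⟩
    · exact .inr ⟨rfl, _, a', a, .parR _ ht, rfl, haa, ha⟩
  | closeR _ _ ih₁ ih₂ =>
    intro W f E hE
    obtain ⟨A, B, rfl, rfl, rfl⟩ := Scoped.map_eq_par hE
    rcases ih₁ f A rfl with ⟨s, hs, e⟩ | ⟨hr, -⟩
    swap; · simp [Residual.subject] at hr
    rcases ih₂ f B rfl with ⟨t, ht, e'⟩ | ⟨hr, -⟩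
    swap; · simp [Residual.subject] at hr
    obtain ⟨a, A', rfl, rfl, rfl⟩ := Residual.map_eq_bout e'
    obtain ⟨a', B', rfl, ha, rfl⟩ := Residual.map_eq_inp e
    by_cases haa : a' = a
    · subst haa
      exact .inl ⟨_, .closeR hs ht, rfl⟩
    · exact .inr ⟨rfl, _, a', a, .parL _ hs, rfl, haa, ha⟩
  | resTau _ ih =>
    intro W f E hE
    obtain ⟨A, rfl, rfl⟩ := Scoped.map_eq_res hE
    rcases ih _ A rfl with ⟨s, hs, e⟩ | ⟨-, hm⟩
    · obtain ⟨A', rfl, rfl⟩ := Residual.map_eq_tau e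
      exact .inl ⟨_, .resTau hs, rfl⟩
    · exact .inr ⟨rfl, hm.res⟩
  | resInp _ ih =>
    intro W f E hE
    obtain ⟨A, rfl, rfl⟩ := Scoped.map_eq_res hE
    rcases ih _ A rfl with ⟨s, hs, e⟩ | ⟨hr, -⟩
    swap; · simp [Residual.subject] at hr
    obtain ⟨a, A', rfl, ha, rfl⟩ := Residual.map_eq_inp e
    obtain ⟨a, rfl, rfl⟩ := Option.map_eq_some_iff.1 ha
    refine .inl ⟨_, .resInp hs, ?_⟩
    simp [Residual.map, Scoped.map, Scoped.map_map, swap_map]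
  | resBout _ ih =>
    intro W f E hE
    obtain ⟨A, rfl, rfl⟩ := Scoped.map_eq_res hE
    rcases ih _ A rfl with ⟨s, hs, e⟩ | ⟨hr, -⟩
    swap; · simp [Residual.subject] at hr
    obtain ⟨a, A', rfl, ha, rfl⟩ := Residual.map_eq_bout e
    obtain ⟨a, rfl, rfl⟩ := Option.map_eq_some_iff.1 ha
    refine .inl ⟨_, .resBout hs, ?_⟩
    simp [Residual.map, Scoped.map, Scoped.map_map, swap_map]
  | resOut _ ih =>
    intro W f E hE
    obtain ⟨A, rfl, rfl⟩ := Scoped.map_eq_res hE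
    rcases ih _ A rfl with ⟨s, hs, e⟩ | ⟨hr, -⟩
    swap; · simp [Residual.subject] at hr
    obtain ⟨a, b, A', rfl, ha, hb, rfl⟩ := Residual.map_eq_out e
    obtain ⟨a, rfl, rfl⟩ := Option.map_eq_some_iff.1 ha
    obtain ⟨b, rfl, rfl⟩ := Option.map_eq_some_iff.1 hb
    exact .inl ⟨_, .resOut hs, rfl⟩
  | opn _ ih =>
    intro W f E hE
    obtain ⟨A, rfl, rfl⟩ := Scoped.map_eq_res hE
    rcases ih _ A rfl with ⟨s, hs, e⟩ | ⟨hr, -⟩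
    swap; · simp [Residual.subject] at hr
    obtain ⟨a, b, A', rfl, ha, hb, rfl⟩ := Residual.map_eq_out e
    obtain ⟨a, rfl, rfl⟩ := Option.map_eq_some_iff.1 ha
    obtain rfl := Option.map_eq_none_iff.1 hb
    exact .inl ⟨_, .opn hs, rfl⟩
  | rep _ ih =>
    intro W f E hE
    obtain ⟨A, rfl, rfl⟩ := Scoped.map_eq_rep hE
    rcases ih f (.par A (.rep A)) rfl with ⟨s, hs, rfl⟩ | ⟨hr, s, a, a', hs, hm⟩
    · exact .inl ⟨s, .rep hs, rfl⟩
    · exact .inr ⟨hr, s, a, a', .rep hs, hm⟩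

theorem Trans.lifts {V W : Type u} {f : W → V} {E : Scoped W} {r : Residual V}
    (h : Trans (E.map f) r) (hr : r.subject ≠ none) : Lifts f E r :=
  (h.reflect f E rfl).resolve_right fun h => hr h.1

/-! ## Invisible well-scoped terms -/

/-- `A` reaches `B` by internal transitions. -/
def Scoped.Reach {V : Type u} : Scoped V → Scoped V → Prop :=
  Relation.ReflTransGen fun A B => Trans A (.tau B)

def Scoped.Visible {V : Type u} (A : Scoped V) : Prop :=
  ∃ B r, A.Reach B ∧ Trans B r ∧ r.subject ≠ none

theorem Scoped.Visible.of_tau {V : Type u} {A B : Scoped V} (h : Trans A (.tau B))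
    (hB : B.Visible) : A.Visible := by
  obtain ⟨C, r, hC, hr⟩ := hB
  exact ⟨C, r, .head h hC, hr⟩

/-- Follow the run of the instance as long as its steps lift. A step that fails to lift comes with a
visible action of the term reached so far. -/
theorem Scoped.Visible.of_map {V W : Type u} {f : V → W} {A : Scoped V}
    (h : (A.map f).Visible) : A.Visible := by
  obtain ⟨B, r, hB, hr, hs⟩ := h
  generalize hA : A.map f = A₀ at hB
  induction hB using Relation.ReflTransGen.head_induction_on generalizing A with
  | refl =>
    subst hA
    obtain ⟨s, hs', rfl⟩ := hr.lifts hs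
    exact ⟨A, s, .refl, hs', by simpa [Residual.subject_map] using hs⟩
  | head h _ ih =>
    rcases h.reflect f A hA with ⟨s, hs', e⟩ | ⟨-, s, a, a', hs', ha, -⟩
    · obtain ⟨A', rfl, hA'⟩ := Residual.map_eq_tau e
      exact .of_tau hs' (ih hA')
    · exact ⟨A, s, .refl, hs', by simp [ha]⟩

/-! ## The simulation -/

/-- `Below A B`: every transition of `A` is one of `B`, as `B` is a sum that contains `A`, or a
replication that unfolds to `A`. -/
inductive Below : {V : Type u} → Scoped V → Scoped V → Prop
  | refl {V} (A : Scoped V) : Below A A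
  | sumL {V} {A B : Scoped V} (C) : Below A B → Below A (.sum B C)
  | sumR {V} {A C : Scoped V} (B) : Below A C → Below A (.sum B C)
  | rep {V} {A B : Scoped V} : Below A (.par B (.rep B)) → Below A (.rep B)

theorem Below.trans {V : Type u} {A B C : Scoped V} (h : Below A B) (h' : Below B C) :
    Below A C := by
  induction h' with
  | refl => exact h
  | sumL _ _ ih => exact .sumL _ ih
  | sumR _ _ ih => exact .sumR _ ih
  | rep _ ih => exact .rep ih

theorem Below.map {V W : Type u} (f : V → W) {A B : Scoped V} (h : Below A B) :
    Below (A.map f) (B.map f) := by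
  induction h with
  | refl => exact .refl _
  | sumL _ _ ih => exact .sumL _ ih
  | sumR _ _ ih => exact .sumR _ ih
  | rep _ ih => exact .rep ih

theorem Below.trans_of {V : Type u} {A B : Scoped V} (h : Below A B) {r : Residual V}
    (hA : Trans A r) : Trans B r := by
  induction h with
  | refl => exact hA
  | sumL _ _ ih => exact .sumL _ ih
  | sumR _ _ ih => exact .sumR _ ih
  | rep _ ih => exact .rep ih

/-- `Sim A B`: `B` arises from `A` when invisible sub-terms are replaced, up to `Below`. -/
inductive Sim : {V : Type u} → Scoped V → Scoped V → Prop
  | invisible {V} {A : Scoped V} (B) : ¬ A.Visible → Sim A B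
  | tau {V} {A A' B : Scoped V} : Sim A A' → Below (.tau A') B → Sim (.tau A) B
  | inp {V} {a : V} {A A' B} : Sim A A' → Below (.inp a A') B → Sim (.inp a A) B
  | out {V} {a b : V} {A A' B} : Sim A A' → Below (.out a b A') B → Sim (.out a b A) B
  | sum {V} {A₁ A₂ A₁' A₂' B : Scoped V} : Sim A₁ A₁' → Sim A₂ A₂' → Below (.sum A₁' A₂') B →
      Sim (.sum A₁ A₂) B
  | par {V} {A₁ A₂ A₁' A₂' B : Scoped V} : Sim A₁ A₁' → Sim A₂ A₂' → Below (.par A₁' A₂') B →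
      Sim (.par A₁ A₂) B
  | res {V} {A A' : Scoped (Option V)} {B} : Sim A A' → Below (.res A') B → Sim (.res A) B
  | rep {V} {A A' B : Scoped V} : Sim A A' → Below (.rep A') B → Sim (.rep A) B

theorem Sim.mono {V : Type u} {A B C : Scoped V} (h : Sim A B) (h' : Below B C) : Sim A C := by
  cases h with
  | invisible _ h => exact .invisible _ h
  | tau h hb => exact .tau h (hb.trans h')
  | inp h hb => exact .inp h (hb.trans h')
  | out h hb => exact .out h (hb.trans h')
  | sum h₁ h₂ hb => exact .sum h₁ h₂ (hb.trans h')
  | par h₁ h₂ hb => exact .par h₁ h₂ (hb.trans h')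
  | res h hb => exact .res h (hb.trans h')
  | rep h hb => exact .rep h (hb.trans h')

/-- This is why `Sim` needs no constructor for `nil`. -/
theorem not_visible_nil {V : Type u} : ¬ (Scoped.nil : Scoped V).Visible := by
  rintro ⟨B, r, hB, hr, -⟩
  rcases Relation.ReflTransGen.cases_head hB with rfl | ⟨C, hC, -⟩
  · cases hr
  · cases hC

theorem Sim.refl {V : Type u} (A : Scoped V) : Sim A A := by
  induction A with
  | nil => exact .invisible _ not_visible_nil
  | tau _ ih => exact .tau ih (.refl _)
  | inp _ _ ih => exact .inp ih (.refl _)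
  | out _ _ _ ih => exact .out ih (.refl _)
  | sum _ _ ih₁ ih₂ => exact .sum ih₁ ih₂ (.refl _)
  | par _ _ ih₁ ih₂ => exact .par ih₁ ih₂ (.refl _)
  | res _ ih => exact .res ih (.refl _)
  | rep _ ih => exact .rep ih (.refl _)

/-- The case of an invisible sub-term is where stability under substitution enters. Communication
needs this for the received name, and scope changes need it for weakening and `swap`. -/
theorem Sim.map {V W : Type u} (f : V → W) {A B : Scoped V} (h : Sim A B) :
    Sim (A.map f) (B.map f) := by
  induction h generalizing W with
  | invisible _ h => exact .invisible _ (mt Scoped.Visible.of_map h)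
  | tau _ hb ih => exact .tau (ih f) (hb.map f)
  | inp _ hb ih => exact .inp (ih _) (hb.map f)
  | out _ hb ih => exact .out (ih f) (hb.map f)
  | sum _ _ hb ih₁ ih₂ => exact .sum (ih₁ f) (ih₂ f) (hb.map f)
  | par _ _ hb ih₁ ih₂ => exact .par (ih₁ f) (ih₂ f) (hb.map f)
  | res _ hb ih => exact .res (ih _) (hb.map f)
  | rep _ hb ih => exact .rep (ih f) (hb.map f)

/-! ### Answering transitions -/

/-- `B` can answer the transition `r`; it may ignore it if it is internal. -/
inductive Answers {V : Type u} : Residual V → Scoped V → Prop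
  | idle {A B} : Sim A B → Answers (.tau A) B
  | tau {A B B'} : Sim A B' → Trans B (.tau B') → Answers (.tau A) B
  | inp {a A B B'} : Sim A B' → Trans B (.inp a B') → Answers (.inp a A) B
  | out {a b A B B'} : Sim A B' → Trans B (.out a b B') → Answers (.out a b A) B
  | bout {a A B B'} : Sim A B' → Trans B (.bout a B') → Answers (.bout a A) B

/-- The idle case is the purpose of `Below`: when a summand or an unfolded replication takes an
internal step that is answered by idling, the other side has not yet chosen or unfolded, and must
still be related to the target. -/
theorem Answers.below {V : Type u} {r : Residual V} {B C : Scoped V} (h : Answers r B)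
    (h' : Below B C) : Answers r C := by
  cases h with
  | idle h => exact .idle (h.mono h')
  | tau h t => exact .tau h (h'.trans_of t)
  | inp h t => exact .inp h (h'.trans_of t)
  | out h t => exact .out h (h'.trans_of t)
  | bout h t => exact .bout h (h'.trans_of t)

/-- The transition must be internal, its target is again invisible, and an invisible term is related
to everything. -/
theorem Sim.answers_of_not_visible {V : Type u} {A : Scoped V} {r : Residual V} (h : Trans A r)
    (hA : ¬ A.Visible) (B : Scoped V) : Answers r B := by
  by_cases hr : r.subject = none
  · match r with
    | .tau A' => exact .idle (.invisible _ fun hv => hA (.of_tau h hv))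
  · exact absurd ⟨A, r, .refl, h, hr⟩ hA

theorem Answers.parL {V : Type u} {r : Residual V} {A B B' : Scoped V} (h : Answers r A)
    (hB : Sim B B') : Answers (r.parL B) (.par A B') := by
  cases h with
  | idle h => exact .idle (.par h hB (.refl _))
  | tau h t => exact .tau (.par h hB (.refl _)) (.parL _ t)
  | inp h t => exact .inp (.par h (hB.map _) (.refl _)) (.parL _ t)
  | out h t => exact .out (.par h hB (.refl _)) (.parL _ t)
  | bout h t => exact .bout (.par h (hB.map _) (.refl _)) (.parL _ t)

theorem Answers.parR {V : Type u} {r : Residual V} {A B B' : Scoped V} (h : Answers r A)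
    (hB : Sim B B') : Answers (r.parR B) (.par B' A) := by
  cases h with
  | idle h => exact .idle (.par hB h (.refl _))
  | tau h t => exact .tau (.par hB h (.refl _)) (.parR _ t)
  | inp h t => exact .inp (.par (hB.map _) h (.refl _)) (.parR _ t)
  | out h t => exact .out (.par hB h (.refl _)) (.parR _ t)
  | bout h t => exact .bout (.par (hB.map _) h (.refl _)) (.parR _ t)

/-- Induction on the derivation, not on the term, since a replication unfolds to a larger term.
Whenever the source itself is invisible, idling suffices; otherwise the outermost constructors match
up to `Below`. -/
theorem Sim.answers {V : Type u} {A : Scoped V} {r : Residual V} (h : Trans A r) :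
    ∀ {B : Scoped V}, Sim A B → Answers r B := by
  induction h with
  | tau A =>
    intro B hB
    cases hB with
    | invisible _ h => exact Sim.answers_of_not_visible (.tau A) h _
    | tau h hb => exact (Answers.tau h (.tau _)).below hb
  | inp a A =>
    intro B hB
    cases hB with
    | invisible _ h => exact Sim.answers_of_not_visible (.inp a A) h _
    | inp h hb => exact (Answers.inp h (.inp _ _)).below hb
  | out a b A =>
    intro B hB
    cases hB with
    | invisible _ h => exact Sim.answers_of_not_visible (.out a b A) h _
    | out h hb => exact (Answers.out h (.out _ _ _)).below hb
  | sumL B t ih =>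
    intro B hB
    cases hB with
    | invisible _ h => exact Sim.answers_of_not_visible (.sumL _ t) h _
    | sum h₁ h₂ hb => exact (ih h₁).below (.trans (.sumL _ (.refl _)) hb)
  | sumR B t ih =>
    intro B hB
    cases hB with
    | invisible _ h => exact Sim.answers_of_not_visible (.sumR _ t) h _
    | sum h₁ h₂ hb => exact (ih h₂).below (.trans (.sumR _ (.refl _)) hb)
  | parL B t ih =>
    intro B hB
    cases hB with
    | invisible _ h => exact Sim.answers_of_not_visible (.parL _ t) h _
    | par h₁ h₂ hb => exact ((ih h₁).parL h₂).below hb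
  | parR B t ih =>
    intro B hB
    cases hB with
    | invisible _ h => exact Sim.answers_of_not_visible (.parR _ t) h _
    | par h₁ h₂ hb => exact ((ih h₂).parR h₁).below hb
  | commL t₁ t₂ ih₁ ih₂ =>
    intro B hB
    cases hB with
    | invisible _ h => exact Sim.answers_of_not_visible (.commL t₁ t₂) h _
    | par h₁ h₂ hb =>
      -- Only internal transitions may be answered by idling, so both partners really answer and can
      -- communicate.
      cases ih₁ h₁ with | out s₁ u₁
      cases ih₂ h₂ with | inp s₂ u₂
      exact (Answers.tau (.par s₁ (s₂.map _) (.refl _)) (.commL u₁ u₂)).below hb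
  | commR t₁ t₂ ih₁ ih₂ =>
    intro B hB
    cases hB with
    | invisible _ h => exact Sim.answers_of_not_visible (.commR t₁ t₂) h _
    | par h₁ h₂ hb =>
      cases ih₁ h₁ with | inp s₁ u₁
      cases ih₂ h₂ with | out s₂ u₂
      exact (Answers.tau (.par (s₁.map _) s₂ (.refl _)) (.commR u₁ u₂)).below hb
  | closeL t₁ t₂ ih₁ ih₂ =>
    intro B hB
    cases hB with
    | invisible _ h => exact Sim.answers_of_not_visible (.closeL t₁ t₂) h _
    | par h₁ h₂ hb =>
      cases ih₁ h₁ with | bout s₁ u₁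
      cases ih₂ h₂ with | inp s₂ u₂
      exact (Answers.tau (.res (.par s₁ s₂ (.refl _)) (.refl _)) (.closeL u₁ u₂)).below hb
  | closeR t₁ t₂ ih₁ ih₂ =>
    intro B hB
    cases hB with
    | invisible _ h => exact Sim.answers_of_not_visible (.closeR t₁ t₂) h _
    | par h₁ h₂ hb =>
      cases ih₁ h₁ with | inp s₁ u₁
      cases ih₂ h₂ with | bout s₂ u₂
      exact (Answers.tau (.res (.par s₁ s₂ (.refl _)) (.refl _)) (.closeR u₁ u₂)).below hb
  | resTau t ih =>
    intro B hB
    cases hB with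
    | invisible _ h => exact Sim.answers_of_not_visible (.resTau t) h _
    | res h hb =>
      cases ih h with
      | idle s => exact (Answers.idle (.res s (.refl _))).below hb
      | tau s u => exact (Answers.tau (.res s (.refl _)) (.resTau u)).below hb
  | resInp t ih =>
    intro B hB
    cases hB with
    | invisible _ h => exact Sim.answers_of_not_visible (.resInp t) h _
    | res h hb =>
      cases ih h with | inp s u
      exact (Answers.inp (.res (s.map _) (.refl _)) (.resInp u)).below hb
  | resOut t ih =>
    intro B hB
    cases hB with
    | invisible _ h => exact Sim.answers_of_not_visible (.resOut t) h _
    | res h hb =>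
      cases ih h with | out s u
      exact (Answers.out (.res s (.refl _)) (.resOut u)).below hb
  | resBout t ih =>
    intro B hB
    cases hB with
    | invisible _ h => exact Sim.answers_of_not_visible (.resBout t) h _
    | res h hb =>
      cases ih h with | bout s u
      exact (Answers.bout (.res (s.map _) (.refl _)) (.resBout u)).below hb
  | opn t ih =>
    intro B hB
    cases hB with
    | invisible _ h => exact Sim.answers_of_not_visible (.opn t) h _
    | res h hb =>
      cases ih h with | out s u
      exact (Answers.bout s (.opn u)).below hb
  | rep t ih =>
    intro B hB
    cases hB with
    | invisible _ h => exact Sim.answers_of_not_visible (.rep t) h _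
    | rep h hb =>
      -- The unfoldings are related, and the unfolding of the other side is `Below` its replication.
      exact (ih (.par h (.rep h (.refl _)) (.refl _))).below (.trans (.rep (.refl _)) hb)

theorem Sim.visible {V : Type u} {A B : Scoped V} (h : Sim A B) (hA : A.Visible) : B.Visible := by
  obtain ⟨C, r, hC, hr, hs⟩ := hA
  induction hC using Relation.ReflTransGen.head_induction_on generalizing B with
  | refl =>
    cases Sim.answers hr h with
    | idle | tau => exact absurd rfl hs
    | inp _ u | out _ u | bout _ u => exact ⟨B, _, .refl, u, by simp [Residual.subject]⟩
  | head t _ ih =>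
    cases Sim.answers t h with
    | idle h' => exact ih h'
    | tau h' u => exact .of_tau u (ih h')

end Pi

/-! ## Embedding of the terms into the well-scoped terms -/

namespace Pi

universe u

variable {Name : Type u} [DecidableEq Name]

/-- The environment `ρ` below a binder of `x`. -/
def bind {V : Type u} (x : Name) (ρ : Name → V) (n : Name) : Option V :=
  if n = x then none else some (ρ n)

/-- The well-scoped term of `P`, where the free names are interpreted by `ρ`. -/
def Proc.embed : {V : Type u} → Proc Name → (Name → V) → Scoped V
  | _, .nil, _ => .nil
  | _, .tau P, ρ => .tau (P.embed ρ)
  | _, .inp a x P, ρ => .inp (ρ a) (P.embed (bind x ρ))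
  | _, .out a b P, ρ => .out (ρ a) (ρ b) (P.embed ρ)
  | _, .sum P Q, ρ => .sum (P.embed ρ) (Q.embed ρ)
  | _, .par P Q, ρ => .par (P.embed ρ) (Q.embed ρ)
  | _, .res x P, ρ => .res (P.embed (bind x ρ))
  | _, .rep P, ρ => .rep (P.embed ρ)

section embed

variable {V W : Type u}

theorem bind_self (x : Name) (ρ : Name → V) : bind x ρ x = none := if_pos rfl

theorem bind_of_ne {x n : Name} (h : n ≠ x) (ρ : Name → V) : bind x ρ n = some (ρ n) := if_neg h

theorem bind_eq_none {x n : Name} {ρ : Name → V} (h : bind x ρ n = none) : n = x := by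
  by_contra hn
  simp [bind_of_ne hn] at h

theorem bind_eq_some {x n : Name} {ρ : Name → V} {v : V} (h : bind x ρ n = some v) :
    n ≠ x ∧ ρ n = v := by
  by_cases hn : n = x
  · simp [hn, bind_self] at h
  · exact ⟨hn, by simpa [bind_of_ne hn] using h⟩

theorem bind_injective {ρ : Name → V} (hρ : ρ.Injective) (x : Name) : (bind x ρ).Injective := by
  intro m n h
  rcases hn : bind x ρ n with _ | v
  · rw [bind_eq_none hn, bind_eq_none (h.trans hn)]
  · exact hρ ((bind_eq_some (h.trans hn)).2.trans (bind_eq_some hn).2.symm)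

theorem map_comp_bind (f : V → W) (x : Name) (ρ : Name → V) :
    Option.map f ∘ bind x ρ = bind x (f ∘ ρ) := by
  funext n
  by_cases h : n = x <;> simp [bind, h]

theorem inst_comp_bind (x : Name) (ρ : Name → V) (b : V) :
    inst b ∘ bind x ρ = Function.update ρ x b := by
  funext n
  by_cases h : n = x <;> simp [bind, h, inst]

theorem inst_comp_some (b : V) : inst b ∘ some = id := rfl

theorem swap_comp_bind {x y : Name} (h : x ≠ y) (ρ : Name → V) :
    swap ∘ bind x (bind y ρ) = bind y (bind x ρ) := by
  funext n
  by_cases hx : n = x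
  · subst hx; simp [bind, h, swap]
  · by_cases hy : n = y <;> simp [bind, hx, hy, swap, Ne.symm h]

theorem Proc.embed_congr (P : Proc Name) {ρ ρ' : Name → V} (h : ∀ n ∈ P.fn, ρ n = ρ' n) :
    P.embed ρ = P.embed ρ' := by
  have aux : ∀ {V : Type u} {ρ ρ' : Name → V} {x : Name} {S : Finset Name},
      (∀ n ∈ S.erase x, ρ n = ρ' n) → ∀ n ∈ S, bind x ρ n = bind x ρ' n := by
    intro V ρ ρ' x S h n hn
    by_cases hx : n = x
    · simp [bind, hx]
    · simp [bind, hx, h n (Finset.mem_erase.2 ⟨hx, hn⟩)]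
  induction P generalizing V with
  | nil => rfl
  | tau P ih => simp only [embed]; rw [ih h]
  | inp a x P ih =>
    simp only [fn, Finset.mem_insert, forall_eq_or_imp] at h
    simp only [embed]; rw [h.1, ih (aux h.2)]
  | out a b P ih =>
    simp only [fn, Finset.mem_insert, forall_eq_or_imp] at h
    simp only [embed]; rw [h.1, h.2.1, ih h.2.2]
  | sum P Q ih₁ ih₂ =>
    simp only [fn, Finset.mem_union] at h
    simp only [embed]; rw [ih₁ fun n hn => h n (.inl hn), ih₂ fun n hn => h n (.inr hn)]
  | par P Q ih₁ ih₂ =>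
    simp only [fn, Finset.mem_union] at h
    simp only [embed]; rw [ih₁ fun n hn => h n (.inl hn), ih₂ fun n hn => h n (.inr hn)]
  | res x P ih => simp only [embed]; rw [ih (aux h)]
  | rep P ih => simp only [embed]; rw [ih h]

theorem Proc.map_embed (P : Proc Name) (ρ : Name → V) (f : V → W) :
    (P.embed ρ).map f = P.embed (f ∘ ρ) := by
  induction P generalizing V W <;> simp_all [embed, Scoped.map, map_comp_bind]

/-- A binder of a name that does not occur is a weakening. -/
theorem Proc.embed_bind {x : Name} {P : Proc Name} (h : x ∉ P.fn) (ρ : Name → V) :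
    P.embed (bind x ρ) = (P.embed ρ).map some := by
  rw [Proc.map_embed]
  exact P.embed_congr fun n hn => bind_of_ne (fun e => h (by rwa [← e])) ρ

variable [Infinite Name]

theorem Proc.embed_subst (P : Proc Name) (σ : Name → Name) (ρ : Name → V) :
    (P.subst σ).embed ρ = P.embed (ρ ∘ σ) := by
  have aux : ∀ {V : Type u} (ρ : Name → V) (σ : Name → Name) (x : Name) (P : Proc Name),
      let y := fresh ((P.fn.erase x).image σ)
      P.embed (bind y ρ ∘ Function.update σ x y) = P.embed (bind x (ρ ∘ σ)) := by
    intro V ρ σ x P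
    refine P.embed_congr fun n hn => ?_
    by_cases hx : n = x
    · simp [bind, hx]
    -- Freshness of the new bound name is exactly what prevents capture of `σ n`.
    · have : σ n ≠ fresh ((P.fn.erase x).image σ) := fun e =>
        fresh_notMem _ (e ▸ Finset.mem_image_of_mem σ (Finset.mem_erase.2 ⟨hx, hn⟩))
      simp [bind, hx, this]
  induction P generalizing V σ with
  | nil => rfl
  | tau P ih => simp only [subst, embed, ih]
  | inp a x P ih => simp only [subst, embed, ih, aux]; rfl
  | out a b P ih => simp only [subst, embed, ih]; rfl
  | sum P Q ih₁ ih₂ => simp only [subst, embed, ih₁, ih₂]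
  | par P Q ih₁ ih₂ => simp only [subst, embed, ih₁, ih₂]
  | res x P ih => simp only [subst, embed, ih, aux]
  | rep P ih => simp only [subst, embed, ih]

theorem Proc.embed_subst1 (P : Proc Name) (x b : Name) (ρ : Name → V) :
    (P.subst1 x b).embed ρ = (P.embed (bind x ρ)).map (inst (ρ b)) := by
  rw [Proc.subst1, Proc.embed_subst, Proc.map_embed, inst_comp_bind, Function.comp_update,
    Function.comp_id]

theorem Proc.embed_rename {x y : Name} {P : Proc Name} (h : y ∉ P.fn) (ρ : Name → V) :
    (P.subst1 x y).embed (bind y ρ) = P.embed (bind x ρ) := by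
  rw [Proc.subst1, Proc.embed_subst]
  refine P.embed_congr fun n hn => ?_
  by_cases hx : n = x
  · simp [bind, hx]
  · have : n ≠ y := fun e => h (e ▸ hn)
    simp [bind, hx, this]

/-- The reason for well-scoped terms: the rule `alpha` becomes invisible in them. -/
theorem AlphaEq.embed_eq {P Q : Proc Name} (h : AlphaEq P Q) (ρ : Name → V) :
    P.embed ρ = Q.embed ρ := by
  induction h generalizing V with
  | refl => rfl
  | symm _ ih => exact (ih ρ).symm
  | trans _ _ ih₁ ih₂ => exact (ih₁ ρ).trans (ih₂ ρ)
  | inp_rename a x y P h => simp only [Proc.embed, Proc.embed_rename h]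
  | res_rename x y P h => simp only [Proc.embed, Proc.embed_rename h]
  | tau _ ih => simp only [Proc.embed, ih]
  | inp a x _ ih => simp only [Proc.embed, ih]
  | out a b _ ih => simp only [Proc.embed, ih]
  | sum _ _ ih₁ ih₂ => simp only [Proc.embed, ih₁, ih₂]
  | par _ _ ih₁ ih₂ => simp only [Proc.embed, ih₁, ih₂]
  | res x _ ih => simp only [Proc.embed, ih]
  | rep _ ih => simp only [Proc.embed, ih]

omit [Infinite Name] in
/-- If `z` is not free in `Q`, an input of `Q` is determined by what it does with `z`. -/
theorem embed_bind_of_inp {Q Q' : Proc Name} {z : Name} (hz : z ∉ Q.fn) {ρ : Name → V} {a : V}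
    {B : Scoped (Option (Option V))} (h : Trans (Q.embed (bind z ρ)) (.inp (some a) B))
    (hQ : Q'.embed (bind z ρ) = B.map (inst (bind z ρ z))) :
    Trans (Q.embed ρ) (.inp a (Q'.embed (bind z ρ))) := by
  -- The source is now a weakening, and its transition is visible, so it lifts to the term without
  -- `z`; instantiating with `none` undoes the weakening of the target.
  rw [Proc.embed_bind hz] at h
  obtain ⟨s, hs, e⟩ := h.lifts (by simp [Residual.subject])
  obtain ⟨a, B, rfl, ha, rfl⟩ := Residual.map_eq_inp e
  obtain rfl := Option.some_injective _ ha
  rwa [hQ, Scoped.map_map, Scoped.map_eq_self]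
  rintro (_ | v) <;> simp [inst, bind_self]

/-! ## Transitions of a term and of its embedding -/

/-- The transition with action `μ` and target `Q` of a term, seen in the embedding `A`. -/
def Embeds (A : Scoped V) (ρ : Name → V) (Q : Proc Name) : Act Name → Prop
  | .tau => Trans A (.tau (Q.embed ρ))
  | .inp a b => ∃ B, Trans A (.inp (ρ a) B) ∧ Q.embed ρ = B.map (inst (ρ b))
  | .out a b => Trans A (.out (ρ a) (ρ b) (Q.embed ρ))
  | .bout a z => a ≠ z ∧ Trans A (.bout (ρ a) (Q.embed (bind z ρ)))

omit [Infinite Name] in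
theorem Embeds.of_imp {A A' : Scoped V} {ρ : Name → V} {Q : Proc Name} {μ : Act Name}
    (h : Embeds A ρ Q μ) (hA : ∀ r, Trans A r → Trans A' r) : Embeds A' ρ Q μ := by
  cases μ with
  | tau => exact hA _ h
  | inp a b => exact h.imp fun _ h => ⟨hA _ h.1, h.2⟩
  | out a b => exact hA _ h
  | bout a z => exact ⟨h.1, hA _ h.2⟩

theorem Step.embeds {P Q : Proc Name} {μ : Act Name} (h : Step P μ Q) (ρ : Name → V) :
    Embeds (P.embed ρ) ρ Q μ := by
  induction h generalizing V with
  | @alpha P P₁ Q₁ Q μ hP _ hQ ih =>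
    have := ih ρ
    rw [← hP.embed_eq] at this
    cases μ <;> simpa only [Embeds, hQ.embed_eq] using this
  | tau P => exact .tau _
  | inp a x b P => exact ⟨_, .inp _ _, P.embed_subst1 x b ρ⟩
  | out a b P => exact .out _ _ _
  | sumL Q _ ih => exact (ih ρ).of_imp fun _ => .sumL _
  | sumR P _ ih => exact (ih ρ).of_imp fun _ => .sumR _
  | @parL P P' μ Q hz _ ih =>
    have := ih ρ
    cases μ with
    | tau => exact .parL _ this
    | inp a b =>
      obtain ⟨B, hB, e⟩ := this
      refine ⟨_, .parL _ hB, ?_⟩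
      simp only [Proc.embed, Scoped.map, e, Scoped.map_map, inst_comp_some,
        Scoped.map_id]
    | out a b => exact .parL _ this
    | bout a z =>
      refine ⟨this.1, ?_⟩
      rw [Proc.embed, Proc.embed, Proc.embed_bind (hz z (by simp [Act.bn]))]
      exact .parL _ this.2
  | @parR Q Q' μ P hz _ ih =>
    have := ih ρ
    cases μ with
    | tau => exact .parR _ this
    | inp a b =>
      obtain ⟨B, hB, e⟩ := this
      refine ⟨_, .parR _ hB, ?_⟩
      simp only [Proc.embed, Scoped.map, e, Scoped.map_map, inst_comp_some,
        Scoped.map_id]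
    | out a b => exact .parR _ this
    | bout a z =>
      refine ⟨this.1, ?_⟩
      rw [Proc.embed, Proc.embed, Proc.embed_bind (hz z (by simp [Act.bn]))]
      exact .parR _ this.2
  | commL _ _ ih₁ ih₂ =>
    obtain ⟨B, hB, e⟩ := ih₂ ρ
    simp only [Embeds, Proc.embed, e]
    exact .commL (ih₁ ρ) hB
  | commR _ _ ih₁ ih₂ =>
    obtain ⟨B, hB, e⟩ := ih₁ ρ
    simp only [Embeds, Proc.embed, e]
    exact .commR hB (ih₂ ρ)
  | @closeL P P' Q Q' a z hz _ _ ih₁ ih₂ =>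
    obtain ⟨hne, h₁⟩ := ih₁ ρ
    -- Reading the input where `z` is bound turns the received name into the binder's name; the
    -- channel differs from `z` and stays outside.
    obtain ⟨B, hB, e⟩ := ih₂ (bind z ρ)
    rw [bind_of_ne hne] at hB
    exact .closeL h₁ (embed_bind_of_inp hz hB e)
  | @closeR P P' Q Q' a z hz _ _ ih₁ ih₂ =>
    obtain ⟨hne, h₂⟩ := ih₂ ρ
    obtain ⟨B, hB, e⟩ := ih₁ (bind z ρ)
    rw [bind_of_ne hne] at hB
    exact .closeR (embed_bind_of_inp hz hB e) h₂
  | @res P P' μ x hx _ ih =>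
    have := ih (bind x ρ)
    cases μ with
    | tau => exact .resTau this
    | inp a b =>
      simp only [Act.names, Finset.mem_insert, Finset.mem_singleton, not_or] at hx
      obtain ⟨B, hB, e⟩ := this
      rw [bind_of_ne (Ne.symm hx.1)] at hB
      rw [bind_of_ne (Ne.symm hx.2)] at e
      refine ⟨_, .resInp hB, ?_⟩
      simp only [Proc.embed, Scoped.map, e, Scoped.map_map]
      congr 2
      funext o
      rcases o with _ | _ | _ <;> rfl
    | out a b =>
      simp only [Act.names, Finset.mem_insert, Finset.mem_singleton, not_or] at hx
      simp only [Embeds, bind_of_ne (Ne.symm hx.1), bind_of_ne (Ne.symm hx.2)] at this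
      exact .resOut this
    | bout a z =>
      simp only [Act.names, Finset.mem_insert, Finset.mem_singleton, not_or] at hx
      simp only [Embeds, bind_of_ne (Ne.symm hx.1)] at this
      refine ⟨this.1, ?_⟩
      rw [Proc.embed, Proc.embed, ← swap_comp_bind (Ne.symm hx.2), ← Proc.map_embed]
      exact .resBout this.2
  | @opn P P' a z hne _ ih =>
    have := ih (bind z ρ)
    simp only [Embeds, bind_of_ne (Ne.symm hne), bind_self] at this
    exact ⟨Ne.symm hne, .opn this⟩
  | rep _ ih => exact (ih ρ).of_imp fun _ => .rep

/-! ### Realising transitions of the embedding -/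

/-- The term `P` can do the transition of its embedding with residual `r`. -/
def Performs (P : Proc Name) (ρ : Name → V) : Residual V → Prop
  | .tau A => ∃ Q, Step P .tau Q ∧ Q.embed ρ = A
  | .inp a A => ∀ b, ∃ a₀ Q, ρ a₀ = a ∧ Step P (.inp a₀ b) Q ∧ Q.embed ρ = A.map (inst (ρ b))
  | .out a b A => ∃ a₀ b₀ Q, ρ a₀ = a ∧ ρ b₀ = b ∧ Step P (.out a₀ b₀) Q ∧ Q.embed ρ = A
  -- Allowing all but finitely many `z` lets later rules choose `z` fresh for further terms.
  | .bout a A => ∃ S : Finset Name, ∀ z ∉ S, ∃ a₀ Q, ρ a₀ = a ∧ Step P (.bout a₀ z) Q ∧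
      Q.embed (bind z ρ) = A

theorem Performs.of_imp {P P' : Proc Name} {ρ : Name → V} {r : Residual V} (h : Performs P ρ r)
    (hP : ∀ μ Q, Step P μ Q → Step P' μ Q) : Performs P' ρ r := by
  cases r with
  | tau A => exact h.imp fun _ h => ⟨hP _ _ h.1, h.2⟩
  | inp a A =>
    intro b
    obtain ⟨a₀, Q, ha, hs, e⟩ := h b
    exact ⟨a₀, Q, ha, hP _ _ hs, e⟩
  | out a b A =>
    obtain ⟨a₀, b₀, Q, ha, hb, hs, e⟩ := h
    exact ⟨a₀, b₀, Q, ha, hb, hP _ _ hs, e⟩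
  | bout a A =>
    obtain ⟨S, h⟩ := h
    refine ⟨S, fun z hz => ?_⟩
    obtain ⟨a₀, Q, ha, hs, e⟩ := h z hz
    exact ⟨a₀, Q, ha, hP _ _ hs, e⟩

theorem Performs.parL {P Q : Proc Name} {ρ : Name → V} {r : Residual V} (h : Performs P ρ r) :
    Performs (.par P Q) ρ (r.parL (Q.embed ρ)) := by
  cases r with
  | tau A =>
    obtain ⟨P', hs, rfl⟩ := h
    exact ⟨_, .parL Q (by simp [Act.bn]) hs, rfl⟩
  | inp a A =>
    intro b
    obtain ⟨a₀, P', ha, hs, e⟩ := h b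
    refine ⟨a₀, _, ha, .parL Q (by simp [Act.bn]) hs, ?_⟩
    simp only [Proc.embed, Scoped.map, e, Scoped.map_map, inst_comp_some,
      Scoped.map_id]
  | out a b A =>
    obtain ⟨a₀, b₀, P', ha, hb, hs, rfl⟩ := h
    exact ⟨a₀, b₀, _, ha, hb, .parL Q (by simp [Act.bn]) hs, rfl⟩
  | bout a A =>
    obtain ⟨S, h⟩ := h
    refine ⟨S ∪ Q.fn, fun z hz => ?_⟩
    rw [Finset.mem_union, not_or] at hz
    obtain ⟨a₀, P', ha, hs, rfl⟩ := h z hz.1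
    refine ⟨a₀, _, ha, .parL Q (by simpa [Act.bn] using hz.2) hs, ?_⟩
    rw [Proc.embed, Proc.embed_bind hz.2]

theorem Performs.parR {P Q : Proc Name} {ρ : Name → V} {r : Residual V} (h : Performs Q ρ r) :
    Performs (.par P Q) ρ (r.parR (P.embed ρ)) := by
  cases r with
  | tau A =>
    obtain ⟨P', hs, rfl⟩ := h
    exact ⟨_, .parR P (by simp [Act.bn]) hs, rfl⟩
  | inp a A =>
    intro b
    obtain ⟨a₀, P', ha, hs, e⟩ := h b
    refine ⟨a₀, _, ha, .parR P (by simp [Act.bn]) hs, ?_⟩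
    simp only [Proc.embed, Scoped.map, e, Scoped.map_map, inst_comp_some,
      Scoped.map_id]
  | out a b A =>
    obtain ⟨a₀, b₀, P', ha, hb, hs, rfl⟩ := h
    exact ⟨a₀, b₀, _, ha, hb, .parR P (by simp [Act.bn]) hs, rfl⟩
  | bout a A =>
    obtain ⟨S, h⟩ := h
    refine ⟨S ∪ P.fn, fun z hz => ?_⟩
    rw [Finset.mem_union, not_or] at hz
    obtain ⟨a₀, P', ha, hs, rfl⟩ := h z hz.1
    refine ⟨a₀, _, ha, .parR P (by simpa [Act.bn] using hz.2) hs, ?_⟩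
    rw [Proc.embed, Proc.embed_bind hz.2]

/-- Transitions create no free names, so the abstraction `B` does not mention `ρ z`. Its instance at
`ρ z` therefore determines it: abstract `ρ z` again. -/
theorem embed_bind_of_fresh_inp {Q Q' : Proc Name} {z : Name} (hz : z ∉ Q.fn) {ρ : Name → V}
    (hρ : ρ.Injective) {a : V} {B : Scoped (Option V)} (h : Trans (Q.embed ρ) (.inp a B))
    (hQ : Q'.embed ρ = B.map (inst (ρ z))) : Q'.embed (bind z ρ) = B := by
  classical
  obtain ⟨w, hw⟩ := Infinite.exists_notMem_finset {z}
  have hwz : ρ w ≠ ρ z := fun e => hw (by simp [hρ e])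
  -- `g` removes `ρ z` from `V` but fixes the embedding of `Q`. Lifting the transition along `g`
  -- shows that `B` lies in the image of `g`, and so avoids `ρ z`.
  let g : V → V := fun v => if v = ρ z then ρ w else v
  have hg : ∀ v, g v ≠ ρ z := fun v => by
    by_cases hv : v = ρ z <;> simp [g, hv, hwz]
  have hQg : (Q.embed ρ).map g = Q.embed ρ := by
    rw [Proc.map_embed]
    exact Q.embed_congr fun n hn => if_neg fun e => hz (by rwa [← hρ e])
  rw [← hQg] at h
  obtain ⟨s, -, e⟩ := h.lifts (by simp [Residual.subject])
  obtain ⟨-, C, -, -, rfl⟩ := Residual.map_eq_inp e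
  let k : V → Option V := fun v => if v = ρ z then none else some v
  have hk : bind z ρ = k ∘ ρ := by
    funext n
    simp [bind, k, hρ.eq_iff]
  rw [hk, ← Proc.map_embed, hQ, Scoped.map_map, Scoped.map_map]
  congr 1
  funext o
  rcases o with _ | v
  · simp [inst, k]
  · simp [inst, k, hg v]

theorem exists_alphaEq_res (S : Finset Name) (x : Name) (P : Proc Name) :
    ∃ y ∉ S, ∃ P', AlphaEq (.res x P) (.res y P') ∧
      ∀ {V : Type u} (ρ : Name → V), P'.embed (bind y ρ) = P.embed (bind x ρ) := by
  have h := fresh_notMem (S ∪ P.fn)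
  rw [Finset.mem_union, not_or] at h
  exact ⟨_, h.1, _, .res_rename x _ P h.2, fun ρ => Proc.embed_rename h.2 ρ⟩

section inversion

omit [Infinite Name]

variable {ρ : Name → V} {P : Proc Name}

theorem Proc.embed_eq_tau {A : Scoped V} (h : P.embed ρ = .tau A) :
    ∃ P₁, P = .tau P₁ ∧ P₁.embed ρ = A := by
  cases P <;> simp_all [Proc.embed]

theorem Proc.embed_eq_inp {a} {A : Scoped (Option V)} (h : P.embed ρ = .inp a A) :
    ∃ a₀ x P₁, P = .inp a₀ x P₁ ∧ ρ a₀ = a ∧ P₁.embed (bind x ρ) = A := by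
  cases P <;> simp_all [Proc.embed]

theorem Proc.embed_eq_out {a b} {A : Scoped V} (h : P.embed ρ = .out a b A) :
    ∃ a₀ b₀ P₁, P = .out a₀ b₀ P₁ ∧ ρ a₀ = a ∧ ρ b₀ = b ∧ P₁.embed ρ = A := by
  cases P <;> simp_all [Proc.embed]

theorem Proc.embed_eq_sum {A B : Scoped V} (h : P.embed ρ = .sum A B) :
    ∃ P₁ P₂, P = .sum P₁ P₂ ∧ P₁.embed ρ = A ∧ P₂.embed ρ = B := by
  cases P <;> simp_all [Proc.embed]

theorem Proc.embed_eq_par {A B : Scoped V} (h : P.embed ρ = .par A B) :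
    ∃ P₁ P₂, P = .par P₁ P₂ ∧ P₁.embed ρ = A ∧ P₂.embed ρ = B := by
  cases P <;> simp_all [Proc.embed]

theorem Proc.embed_eq_res {A : Scoped (Option V)} (h : P.embed ρ = .res A) :
    ∃ x P₁, P = .res x P₁ ∧ P₁.embed (bind x ρ) = A := by
  cases P <;> simp_all [Proc.embed]

theorem Proc.embed_eq_rep {A : Scoped V} (h : P.embed ρ = .rep A) :
    ∃ P₁, P = .rep P₁ ∧ P₁.embed ρ = A := by
  cases P <;> simp_all [Proc.embed]

end inversion

/-- Injectivity of `ρ` ensures that two channels that agree in `V` are the same name, so that a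
communication of the embedding is one of the term. -/
theorem Trans.performs {A : Scoped V} {r : Residual V} (h : Trans A r) :
    ∀ {P : Proc Name} {ρ : Name → V}, ρ.Injective → P.embed ρ = A → Performs P ρ r := by
  induction h with
  | tau A =>
    intro P ρ hρ hP
    obtain ⟨P, rfl, rfl⟩ := Proc.embed_eq_tau hP
    exact ⟨P, .tau P, rfl⟩
  | inp a A =>
    intro P ρ hρ hP b
    obtain ⟨a, x, P, rfl, rfl, rfl⟩ := Proc.embed_eq_inp hP
    exact ⟨a, _, rfl, .inp a x b P, P.embed_subst1 x b ρ⟩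
  | out a b A =>
    intro P ρ hρ hP
    obtain ⟨a, b, P, rfl, rfl, rfl, rfl⟩ := Proc.embed_eq_out hP
    exact ⟨a, b, P, rfl, rfl, .out a b P, rfl⟩
  | sumL B _ ih =>
    intro P ρ hρ hP
    obtain ⟨P, Q, rfl, rfl, rfl⟩ := Proc.embed_eq_sum hP
    exact (ih hρ rfl).of_imp fun _ _ => .sumL Q
  | sumR A _ ih =>
    intro P ρ hρ hP
    obtain ⟨P, Q, rfl, rfl, rfl⟩ := Proc.embed_eq_sum hP
    exact (ih hρ rfl).of_imp fun _ _ => .sumR P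
  | parL B _ ih =>
    intro P ρ hρ hP
    obtain ⟨P, Q, rfl, rfl, rfl⟩ := Proc.embed_eq_par hP
    exact (ih hρ rfl).parL
  | parR A _ ih =>
    intro P ρ hρ hP
    obtain ⟨P, Q, rfl, rfl, rfl⟩ := Proc.embed_eq_par hP
    exact (ih hρ rfl).parR
  | commL _ _ ih₁ ih₂ =>
    intro P ρ hρ hP
    obtain ⟨P, Q, rfl, rfl, rfl⟩ := Proc.embed_eq_par hP
    obtain ⟨a, b, P', rfl, rfl, h₁, rfl⟩ := ih₁ hρ rfl
    obtain ⟨a', Q', ha, h₂, e⟩ := ih₂ hρ rfl b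
    obtain rfl := hρ ha
    exact ⟨_, .commL h₁ h₂, by rw [Proc.embed, e]⟩
  | commR _ _ ih₁ ih₂ =>
    intro P ρ hρ hP
    obtain ⟨P, Q, rfl, rfl, rfl⟩ := Proc.embed_eq_par hP
    obtain ⟨a, b, Q', rfl, rfl, h₂, rfl⟩ := ih₂ hρ rfl
    obtain ⟨a', P', ha, h₁, e⟩ := ih₁ hρ rfl b
    obtain rfl := hρ ha
    exact ⟨_, .commR h₁ h₂, by rw [Proc.embed, e]⟩
  | closeL _ t ih₁ ih₂ =>
    intro P ρ hρ hP
    obtain ⟨P, Q, rfl, rfl, rfl⟩ := Proc.embed_eq_par hP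
    obtain ⟨S, h⟩ := ih₁ hρ rfl
    obtain ⟨z, hz⟩ := Infinite.exists_notMem_finset (S ∪ Q.fn)
    rw [Finset.mem_union, not_or] at hz
    obtain ⟨a, P', rfl, h₁, rfl⟩ := h z hz.1
    obtain ⟨a', Q', ha, h₂, e⟩ := ih₂ hρ rfl z
    obtain rfl := hρ ha
    refine ⟨_, .closeL hz.2 h₁ h₂, ?_⟩
    rw [Proc.embed, Proc.embed, embed_bind_of_fresh_inp hz.2 hρ t e]
  | closeR t _ ih₁ ih₂ =>
    intro P ρ hρ hP
    obtain ⟨P, Q, rfl, rfl, rfl⟩ := Proc.embed_eq_par hP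
    obtain ⟨S, h⟩ := ih₂ hρ rfl
    obtain ⟨z, hz⟩ := Infinite.exists_notMem_finset (S ∪ P.fn)
    rw [Finset.mem_union, not_or] at hz
    obtain ⟨a, Q', rfl, h₂, rfl⟩ := h z hz.1
    obtain ⟨a', P', ha, h₁, e⟩ := ih₁ hρ rfl z
    obtain rfl := hρ ha
    refine ⟨_, .closeR hz.2 h₁ h₂, ?_⟩
    rw [Proc.embed, Proc.embed, embed_bind_of_fresh_inp hz.2 hρ t e]
  | resTau _ ih =>
    intro P ρ hρ hP
    obtain ⟨x, P, rfl, rfl⟩ := Proc.embed_eq_res hP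
    obtain ⟨Q, hs, rfl⟩ := ih (bind_injective hρ x) rfl
    exact ⟨_, .res x (by simp [Act.names]) hs, rfl⟩
  | resInp _ ih =>
    intro P ρ hρ hP b
    obtain ⟨x, P, rfl, rfl⟩ := Proc.embed_eq_res hP
    -- The received name `b` may coincide with the restricted `x`, so the binder is first renamed
    -- away from it.
    obtain ⟨y, hy, P', hα, e⟩ := exists_alphaEq_res {b} x P
    obtain ⟨a, Q, ha, hs, e'⟩ := ih (bind_injective hρ y) (e ρ) b
    obtain ⟨hay, rfl⟩ := bind_eq_some ha
    rw [Finset.mem_singleton] at hy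
    refine ⟨a, _, rfl, .alpha hα (.res y (by simp [Act.names, hy, Ne.symm hay]) hs) (.refl _), ?_⟩
    rw [Proc.embed, e', bind_of_ne (Ne.symm hy), Scoped.map, Scoped.map_map]
    congr 2
    funext o
    rcases o with _ | _ | _ <;> rfl
  | resOut _ ih =>
    intro P ρ hρ hP
    obtain ⟨x, P, rfl, rfl⟩ := Proc.embed_eq_res hP
    obtain ⟨a, b, Q, ha, hb, hs, rfl⟩ := ih (bind_injective hρ x) rfl
    obtain ⟨hax, rfl⟩ := bind_eq_some ha
    obtain ⟨hbx, rfl⟩ := bind_eq_some hb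
    exact ⟨a, b, _, rfl, rfl, .res x (by simp [Act.names, Ne.symm hax, Ne.symm hbx]) hs, rfl⟩
  | resBout _ ih =>
    intro P ρ hρ hP
    obtain ⟨x, P, rfl, rfl⟩ := Proc.embed_eq_res hP
    obtain ⟨S, h⟩ := ih (bind_injective hρ x) rfl
    refine ⟨insert x S, fun z hz => ?_⟩
    rw [Finset.mem_insert, not_or] at hz
    obtain ⟨a, Q, ha, hs, rfl⟩ := h z hz.2
    obtain ⟨hax, rfl⟩ := bind_eq_some ha
    refine ⟨a, _, rfl, .res x (by simp [Act.names, Ne.symm hax, Ne.symm hz.1]) hs, ?_⟩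
    rw [Proc.embed, Proc.map_embed, swap_comp_bind hz.1]
  | opn _ ih =>
    intro P ρ hρ hP
    obtain ⟨x, P, rfl, rfl⟩ := Proc.embed_eq_res hP
    -- The binder can be renamed to any `z` not free in its body, and this `z` is then extruded.
    refine ⟨P.fn, fun z hz => ?_⟩
    obtain ⟨a, b, Q, ha, hb, hs, rfl⟩ :=
      ih (bind_injective hρ z) (Proc.embed_rename (x := x) hz ρ)
    obtain ⟨haz, rfl⟩ := bind_eq_some ha
    obtain rfl := bind_eq_none hb
    exact ⟨a, Q, rfl, .alpha (.res_rename x _ P hz) (.opn (Ne.symm haz) hs) (.refl _), rfl⟩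
  | rep _ ih =>
    intro P ρ hρ hP
    obtain ⟨P, rfl, rfl⟩ := Proc.embed_eq_rep hP
    exact (ih hρ (P := .par P (.rep P)) rfl).of_imp fun _ _ => .rep

end embed

/-! ## Strong replacement freeness -/

variable [Infinite Name]

theorem visible_iff (P : Proc Name) : (calculus Name).Visible P ↔ (P.embed id).Visible := by
  constructor
  · rintro ⟨α, hα, P', Q, Q', hPQ, hQ, -⟩
    induction hPQ using Relation.ReflTransGen.head_induction_on with
    | refl =>
      have := Step.embeds hQ id
      cases α with
      | tau => exact absurd rfl hα
      | inp a b =>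
        obtain ⟨B, hB, -⟩ := this
        exact ⟨_, _, .refl, hB, by simp [Residual.subject]⟩
      | out a b => exact ⟨_, _, .refl, this, by simp [Residual.subject]⟩
      | bout a z => exact ⟨_, _, .refl, this.2, by simp [Residual.subject]⟩
    | head h _ ih => exact .of_tau (Step.embeds h id) ih
  · rintro ⟨B, r, hB, hr, hs⟩
    generalize hP : P.embed id = A at hB
    induction hB using Relation.ReflTransGen.head_induction_on generalizing P with
    | refl =>
      have := hr.performs Function.injective_id hP
      cases r with
      | tau A => exact absurd rfl hs
      | inp a A =>
        -- Any received name would do here.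
        obtain ⟨a₀, Q, -, h, -⟩ := this a
        exact ⟨.inp a₀ a, nofun, Q, P, Q, .refl, h, .refl⟩
      | out a b A =>
        obtain ⟨a₀, b₀, Q, -, -, h, -⟩ := this
        exact ⟨.out a₀ b₀, nofun, Q, P, Q, .refl, h, .refl⟩
      | bout a A =>
        obtain ⟨S, this⟩ := this
        obtain ⟨a₀, Q, -, h, -⟩ := this _ (fresh_notMem S)
        exact ⟨.bout a₀ (fresh S), nofun, Q, P, Q, .refl, h, .refl⟩
    | head h _ ih =>
      obtain ⟨Q, hQ, e⟩ := h.performs Function.injective_id hP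
      obtain ⟨α, hα, P', R, R', hR, h'⟩ := ih Q e
      exact ⟨α, hα, P', R, R', .head hQ hR, h'⟩

omit [Infinite Name] in
-- The environment at the hole collects the binders of the context, so capture appears as the
-- substitution `ρ` applied to `I.embed id`, which keeps it invisible.
theorem Ctx.sim_fill (C : Ctx Name) {I : Proc Name} (hI : ¬ (I.embed id).Visible)
    (P : Proc Name) {V : Type u} (ρ : Name → V) :
    Sim ((C.fill I).embed ρ) ((C.fill P).embed ρ) := by
  induction C generalizing V with
  | hole =>
    refine .invisible _ (mt (fun h => ?_) hI)
    exact Scoped.Visible.of_map (f := ρ) (by rwa [Proc.map_embed])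
  | tau C ih => exact .tau (ih ρ) (.refl _)
  | inp a x C ih => exact .inp (ih _) (.refl _)
  | out a b C ih => exact .out (ih ρ) (.refl _)
  | sumL C Q ih => exact .sum (ih ρ) (.refl _) (.refl _)
  | sumR Q C ih => exact .sum (.refl _) (ih ρ) (.refl _)
  | parL C Q ih => exact .par (ih ρ) (.refl _) (.refl _)
  | parR Q C ih => exact .par (.refl _) (ih ρ) (.refl _)
  | res x C ih => exact .res (ih _) (.refl _)
  | rep C ih => exact .rep (ih ρ) (.refl _)

end Pi

theorem mainTheorem3 (Name : Type*) [DecidableEq Name] [Infinite Name] :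
    (Pi.calculus Name).StronglyReplacementFree := by
  intro C I P hI hC
  have hI' : ¬ (Pi.Proc.embed I id).Visible := mt (Pi.visible_iff I).2 hI
  exact (Pi.visible_iff _).2 ((C.sim_fill hI' P id).visible ((Pi.visible_iff _).1 hC))
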